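/- Let $E$ be a (real) Banach lattice with order continuous norm, i.e. every downward directed set in $E$ with infimum $0$, viewed as a decreasing net, converges to $0$ in norm. Let $Y$ be a (real) Banach space and let $T\colon E\to Y$ be a bounded linear operator. Vectors $x,y\in E$ are disjoint if $|x|\wedge|y|=0$. For a sequence $(x_n)_{n\in\mathbb N}$ in $E$ let $[x_n]$ be the closed linear subspace generated by it, and let $T_{[x_n]}$ be the restriction of $T$ to $[x_n]$. A bounded linear operator $S\colon X\to Y$ between Banach spaces is strictly singular if there is no closed infinite dimensional subspace $M$ of $X$ such that the restriction $S_M$ is an isomorphism (linear homeomorphism) from $M$ onto $S(M)$. The operator $T$ is disjointly non-singular if there is no sequence $(x_n)$ of pairwise disjoint non-zero vectors in $E$ such that $T_{[x_n]}$ is strictly singular. Put $$\Gamma_d(T)=\inf\bigl\{\|T_{[x_n]}\| : (x_n)_{n\in\mathbb N}\ \text{a sequence of pairwise disjoint non-zero vectors in } E\bigr\}\in[0,\infty],$$ with the convention $\inf\emptyset=\infty$ (the infimum is over the empty set only when $E$ contains no such sequence). Then $T$ is disjointly non-singular if and only if $\Gamma_d(T)>0$. -/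

import Mathlib

open scoped ENNReal

noncomputable section

namespace BanachLat

/-- The norm of `E` is order continuous: every (nonempty) downward directed set with infimum `0`,
regarded as a decreasing net, converges to `0` in norm. -/
def OrderContinuousNorm (E : Type*) [NormedAddCommGroup E] [Lattice E] : Prop :=
  ∀ S : Set E, S.Nonempty → DirectedOn (· ≥ ·) S → IsGLB S 0 →
    ∀ ε : ℝ, 0 < ε → ∃ x₀ ∈ S, ∀ x ∈ S, x ≤ x₀ → ‖x‖ < ε

/-- A disjoint sequence of non-zero vectors; `x` and `y` are disjoint when `|x| ⊓ |y| = 0`. -/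
def IsDisjointSeq {E : Type*} [NormedAddCommGroup E] [Lattice E] (x : ℕ → E) : Prop :=
  (∀ n, x n ≠ 0) ∧ ∀ m n, m ≠ n → |x m| ⊓ |x n| = 0

/-- The closed subspace `[x_n]` generated by a sequence. -/
def closedSpan {X : Type*} [NormedAddCommGroup X] [NormedSpace ℝ X] (x : ℕ → X) :
    Submodule ℝ X :=
  (Submodule.span ℝ (Set.range x)).topologicalClosure

/-- The restriction `T_M` of an operator to a subspace `M`. -/
def restrictTo {X Y : Type*} [NormedAddCommGroup X] [NormedSpace ℝ X]
    [NormedAddCommGroup Y] [NormedSpace ℝ Y] (T : X →L[ℝ] Y) (M : Submodule ℝ X) : M →L[ℝ] Y :=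
  T.comp M.subtypeL

/-- `T` is an isomorphism (a linear homeomorphism) from `X` onto its range `TX`. -/
def IsIsoOntoRange {X Y : Type*} [NormedAddCommGroup X] [NormedSpace ℝ X]
    [NormedAddCommGroup Y] [NormedSpace ℝ Y] (T : X →L[ℝ] Y) : Prop :=
  ∃ e : X ≃L[ℝ] LinearMap.range (T : X →ₗ[ℝ] Y), ∀ x, (e x : Y) = T x

/-- `T` is strictly singular: there is no closed infinite dimensional subspace `M` such that
`T_M` is an isomorphism onto its range. -/
def StrictlySingular {X Y : Type*} [NormedAddCommGroup X] [NormedSpace ℝ X]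
    [NormedAddCommGroup Y] [NormedSpace ℝ Y] (T : X →L[ℝ] Y) : Prop :=
  ¬ ∃ M : Submodule ℝ X, IsClosed (M : Set X) ∧ ¬ FiniteDimensional ℝ M ∧
    IsIsoOntoRange (restrictTo T M)

/-- `T` is disjointly non-singular: there is no disjoint sequence of non-zero vectors `(x_n)`
such that the restriction of `T` to `[x_n]` is strictly singular. -/
def DisjointlyNonSingular {E Y : Type*} [NormedAddCommGroup E] [NormedSpace ℝ E] [Lattice E]
    [NormedAddCommGroup Y] [NormedSpace ℝ Y] (T : E →L[ℝ] Y) : Prop :=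
  ¬ ∃ x : ℕ → E, IsDisjointSeq x ∧ StrictlySingular (restrictTo T (closedSpan x))

/-- `Γ_d(T)`, the infimum of the operator norms of the restrictions of `T` to `[x_n]` over all
disjoint sequences of non-zero vectors. It is taken in `[0, ∞]`, so it is `∞` when there are no
such sequences. -/
def Gammad {E Y : Type*} [NormedAddCommGroup E] [NormedSpace ℝ E] [Lattice E]
    [NormedAddCommGroup Y] [NormedSpace ℝ Y] (T : E →L[ℝ] Y) : ℝ≥0∞ :=
  ⨅ (x : ℕ → E) (_ : IsDisjointSeq x), ENNReal.ofReal ‖restrictTo T (closedSpan x)‖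

end BanachLat

end

namespace BanachLat

/-! ### Disjointness and truncation in vector lattices. -/

section VectorLattice

/-! In a finite disjoint sum each term is dominated in norm by the whole sum. Hence if `‖T (x n)‖ ≤
b n * ‖x n‖` along a disjoint sequence and `b` is summable, then `T` is bounded by `∑' n, b n` on
the closed span (`IsDisjointSeq.norm_map_le`) and, by passing to tails, is strictly singular there
(`IsDisjointSeq.strictlySingular`).

If `T` is strictly singular on some `[x_n]`, it is not bounded below on any tail, so disjoint blocks
exist with summable ratios of arbitrarily small sum (`IsDisjointSeq.exists_block`), and `Γ_d(T) =
0`.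

Conversely, `Γ_d(T) = 0` gives for each `k` a disjoint sequence on which `T` is small, but these
sequences are unrelated to one another. Order continuity makes each nearly disjoint from any fixed
vector somewhere along it, so one unit vector can be picked from each and the picks truncated into a
genuinely disjoint sequence (`exists_disjoint_perturbation`) on which `T` still decays
geometrically. -/

lemma smul_posPart {E : Type*} [AddCommGroup E] [Lattice E] [Module ℝ E]
    [IsOrderedModule ℝ E] {c : ℝ} (hc : 0 < c) (x : E) : c • x⁺ = (c • x)⁺ := by
  rw [posPart_def, posPart_def]
  conv_rhs => rw [← smul_zero c]
  exact (OrderIso.smulRight (β := E) hc).map_sup x 0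

lemma smul_inf_smul {E : Type*} [AddCommGroup E] [Lattice E] [Module ℝ E]
    [IsOrderedModule ℝ E] {c : ℝ} (hc : 0 < c) (x y : E) : c • x ⊓ c • y = c • (x ⊓ y) :=
  ((OrderIso.smulRight (β := E) hc).map_inf x y).symm

lemma inf_eq_zero_of_le {E : Type*} [AddCommGroup E] [Lattice E] {a b a' b' : E}
    (hab : a ⊓ b = 0) (ha' : 0 ≤ a') (hb' : 0 ≤ b') (h : a' ≤ a) (h' : b' ≤ b) : a' ⊓ b' = 0 :=
  le_antisymm (hab ▸ inf_le_inf h h') (le_inf ha' hb')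

lemma abs_smul_le {E : Type*} [AddCommGroup E] [Lattice E] [Module ℝ E]
    [IsOrderedModule ℝ E] (c : ℝ) (x : E) : |c • x| ≤ |c| • |x| := by
  have h1 : ∀ (c : ℝ) (x : E), c • x ≤ |c| • |x| := fun c x => by
    rcases le_total 0 c with h | h
    · rw [abs_of_nonneg h]; exact smul_le_smul_of_nonneg_left (le_abs_self x) h
    · rw [abs_of_nonpos h, ← neg_smul_neg]
      exact smul_le_smul_of_nonneg_left (neg_le_abs x) (neg_nonneg.2 h)
  refine abs_le'.2 ⟨h1 c x, ?_⟩
  simpa using h1 (-c) x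

variable {E : Type*} [AddCommGroup E] [Lattice E] [IsOrderedAddMonoid E]

lemma inf_add_le_inf_add_inf {a b c : E} (ha : 0 ≤ a) (hb : 0 ≤ b) (hc : 0 ≤ c) :
    a ⊓ (b + c) ≤ a ⊓ b + a ⊓ c := by
  rw [add_inf, inf_add, inf_add]
  refine le_inf (le_inf ?_ ?_) (le_inf ?_ ?_)
  · exact inf_le_left.trans (le_add_of_nonneg_left ha)
  · exact inf_le_left.trans (le_add_of_nonneg_left hb)
  · exact inf_le_left.trans (le_add_of_nonneg_right hc)
  · exact inf_le_right

lemma abs_le_abs_add_of_disjoint {x y : E} (h : |x| ⊓ |y| = 0) : |x| ≤ |x + y| := by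
  have h1 : |x| ≤ |x + y| + |y| := by
    have := abs_add_le (x + y) (-y)
    rwa [add_neg_cancel_right, abs_neg] at this
  calc |x| = |x| ⊓ (|x + y| + |y|) := (inf_eq_left.2 h1).symm
    _ ≤ |x| ⊓ |x + y| + |x| ⊓ |y| :=
        inf_add_le_inf_add_inf (abs_nonneg _) (abs_nonneg _) (abs_nonneg _)
    _ ≤ |x + y| := by rw [h, add_zero]; exact inf_le_right

/-- The part of `y` exceeding `z ≥ 0` in absolute value. -/
def excess (y z : E) : E := (y⁺ - z)⁺ - (y⁻ - z)⁺

lemma abs_excess_le (y z : E) : |excess y z| ≤ (|y| - z)⁺ := by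
  have hp : (y⁺ - z)⁺ ≤ (|y| - z)⁺ :=
    posPart_mono (sub_le_sub_right (by
      rw [← posPart_add_negPart]; exact le_add_of_nonneg_right (negPart_nonneg _)) _)
  have hn : (y⁻ - z)⁺ ≤ (|y| - z)⁺ :=
    posPart_mono (sub_le_sub_right (by
      rw [← posPart_add_negPart]; exact le_add_of_nonneg_left (posPart_nonneg _)) _)
  refine abs_le'.2 ⟨(sub_le_self _ (posPart_nonneg _)).trans hp, ?_⟩
  rw [excess, neg_sub]
  exact (sub_le_self _ (posPart_nonneg _)).trans hn

/-- What is cut off is `y⁺ ⊓ z - y⁻ ⊓ z`, a difference of two positive elements below `|y| ⊓ z`. -/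
lemma abs_sub_excess_le (y : E) {z : E} (hz : 0 ≤ z) : |y - excess y z| ≤ |y| ⊓ z := by
  have key : y - excess y z = y⁺ ⊓ z - y⁻ ⊓ z := by
    rw [inf_eq_sub_posPart_sub, inf_eq_sub_posPart_sub, excess]
    nth_rewrite 1 [← posPart_sub_negPart y]
    abel
  have hp : y⁺ ⊓ z ≤ |y| ⊓ z := inf_le_inf_right _ (by
      rw [← posPart_add_negPart]; exact le_add_of_nonneg_right (negPart_nonneg _))
  have hn : y⁻ ⊓ z ≤ |y| ⊓ z := inf_le_inf_right _ (by
      rw [← posPart_add_negPart]; exact le_add_of_nonneg_left (posPart_nonneg _))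
  rw [key]
  refine abs_le'.2 ⟨(sub_le_self _ (le_inf (negPart_nonneg _) hz)).trans hp, ?_⟩
  rw [neg_sub]
  exact (sub_le_self _ (le_inf (posPart_nonneg _) hz)).trans hn

variable [Module ℝ E] [IsOrderedModule ℝ E]

lemma inf_eq_zero_of_le_smul {a b a' : E} {c : ℝ} (hab : a ⊓ b = 0) (ha : 0 ≤ a) (hb : 0 ≤ b)
    (ha' : 0 ≤ a') (h : a' ≤ c • a) : a' ⊓ b = 0 := by
  -- A common factor that is at least `c` and at least `1` lets both sides be scaled together.
  have hm : (0 : ℝ) < max c 1 := lt_max_of_lt_right one_pos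
  refine le_antisymm ?_ (le_inf ha' hb)
  calc a' ⊓ b ≤ max c 1 • a ⊓ max c 1 • b := by
        refine inf_le_inf (h.trans (smul_le_smul_of_nonneg_right (le_max_left _ _) ha)) ?_
        simpa using smul_le_smul_of_nonneg_right (le_max_right c 1) hb
    _ = 0 := by rw [smul_inf_smul hm, hab, smul_zero]

/-- The disjoint complement of a vector. -/
def disjointCompl (z : E) : Submodule ℝ E where
  carrier := {y | |y| ⊓ |z| = 0}
  zero_mem' := by simp
  add_mem' {x y} hx hy := by
    refine le_antisymm ?_ (le_inf (abs_nonneg _) (abs_nonneg _))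
    calc |x + y| ⊓ |z| ≤ |z| ⊓ (|x| + |y|) := by
          rw [inf_comm]; exact inf_le_inf_left _ (abs_add_le x y)
      _ ≤ |z| ⊓ |x| + |z| ⊓ |y| :=
          inf_add_le_inf_add_inf (abs_nonneg _) (abs_nonneg _) (abs_nonneg _)
      _ = 0 := by rw [inf_comm, hx, inf_comm, hy, add_zero]
  smul_mem' c x hx :=
    inf_eq_zero_of_le_smul hx (abs_nonneg _) (abs_nonneg _) (abs_nonneg _) (abs_smul_le c x)

lemma mem_disjointCompl {y z : E} : y ∈ disjointCompl z ↔ |y| ⊓ |z| = 0 := Iff.rfl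

lemma mem_disjointCompl_comm {y z : E} : y ∈ disjointCompl z ↔ z ∈ disjointCompl y := by
  rw [mem_disjointCompl, mem_disjointCompl, inf_comm]

lemma disjoint_of_mem_span {s t : Set E} (hst : ∀ a ∈ s, ∀ b ∈ t, |a| ⊓ |b| = 0) {x y : E}
    (hx : x ∈ Submodule.span ℝ s) (hy : y ∈ Submodule.span ℝ t) : |x| ⊓ |y| = 0 := by
  have h1 : ∀ b ∈ t, x ∈ disjointCompl b := fun b hb =>
    (Submodule.span_le.2 fun a ha => hst a ha b hb) hx
  exact mem_disjointCompl_comm.1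
    ((Submodule.span_le.2 fun b hb => mem_disjointCompl_comm.1 (h1 b hb)) hy)

/-- Truncating each of two vectors at the multiples `c • |y|` and `c⁻¹ • |x|` makes them
disjoint. -/
lemma excess_inf_excess_eq_zero {x y u v : E} {c : ℝ} (hc : 0 < c) (hu : c⁻¹ • |y| ≤ u)
    (hv : c • |x| ≤ v) : |excess x u| ⊓ |excess y v| = 0 := by
  -- These are the positive and negative parts of one vector; the two excesses lie below multiples
  -- of them.
  have h0 : (c • |x| - |y|)⁺ ⊓ (|y| - c • |x|)⁺ = 0 := by
    have := posPart_inf_negPart_eq_zero (c • |x| - |y|)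
    rwa [negPart_def, neg_sub] at this
  have hy : |excess y v| ≤ (|y| - c • |x|)⁺ :=
    (abs_excess_le y v).trans (posPart_mono (sub_le_sub_left hv _))
  have hx : |excess x u| ≤ c⁻¹ • (c • |x| - |y|)⁺ := by
    rw [smul_posPart (inv_pos.2 hc), smul_sub, inv_smul_smul₀ hc.ne']
    exact (abs_excess_le x u).trans (posPart_mono (sub_le_sub_left hu _))
  exact inf_eq_zero_of_le
    (inf_eq_zero_of_le_smul h0 (posPart_nonneg _) (posPart_nonneg _)
      ((abs_nonneg _).trans hx) le_rfl) (abs_nonneg _) (abs_nonneg _) hx hy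

/-- For disjoint positive elements the sum equals the supremum. -/
lemma sum_le_of_pairwise_disjoint {w : ℕ → E} {u : E} (hu : 0 ≤ u) (h0 : ∀ n, 0 ≤ w n)
    (hw : ∀ n, w n ≤ u) (hdisj : ∀ m n, m ≠ n → w m ⊓ w n = 0) (n : ℕ) :
    ∑ i ∈ Finset.range n, w i ≤ u := by
  induction n with
  | zero => simpa using hu
  | succ n ih =>
    have hS : 0 ≤ ∑ i ∈ Finset.range n, w i := Finset.sum_nonneg fun i _ => h0 i
    have hd : |∑ i ∈ Finset.range n, w i| ⊓ |w n| = 0 := by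
      refine disjoint_of_mem_span (s := w '' {i | i < n}) (t := {w n}) ?_
        (Submodule.sum_mem _ fun i hi =>
          Submodule.subset_span ⟨i, Finset.mem_range.1 hi, rfl⟩) (Submodule.subset_span rfl)
      rintro _ ⟨i, hi, rfl⟩ _ rfl
      rw [abs_of_nonneg (h0 i), abs_of_nonneg (h0 n)]
      exact hdisj i n (ne_of_lt hi)
    rw [abs_of_nonneg hS, abs_of_nonneg (h0 n)] at hd
    rw [Finset.sum_range_succ, ← inf_add_sup, hd, zero_add]
    exact sup_le ih (hw n)

end VectorLattice

/-! ### Operators bounded below and restrictions. -/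

section Restriction

variable {X Y : Type*} [NormedAddCommGroup X] [NormedSpace ℝ X]
    [NormedAddCommGroup Y] [NormedSpace ℝ Y]

lemma IsIsoOntoRange.exists_norm_le {T : X →L[ℝ] Y} (h : IsIsoOntoRange T) :
    ∃ c : ℝ, 0 ≤ c ∧ ∀ x, ‖x‖ ≤ c * ‖T x‖ := by
  obtain ⟨e, he⟩ := h
  refine ⟨‖(e.symm : LinearMap.range (T : X →ₗ[ℝ] Y) →L[ℝ] X)‖,
    ContinuousLinearMap.opNorm_nonneg _, fun x => ?_⟩
  have := (e.symm : LinearMap.range (T : X →ₗ[ℝ] Y) →L[ℝ] X).le_opNorm (e x)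
  rw [ContinuousLinearEquiv.coe_coe, e.symm_apply_apply] at this
  rw [← he x]
  exact this

lemma isIsoOntoRange_of_norm_le {T : X →L[ℝ] Y} {c : ℝ} (h : ∀ x, ‖x‖ ≤ c * ‖T x‖) :
    IsIsoOntoRange T := by
  have hinj : Function.Injective (T : X →ₗ[ℝ] Y) := by
    rw [injective_iff_map_eq_zero]
    intro x hx
    have := h x
    rw [show T x = 0 from hx, norm_zero, mul_zero] at this
    exact norm_le_zero_iff.1 this
  refine ⟨(LinearEquiv.ofInjective _ hinj).toContinuousLinearEquivOfBounds ‖T‖ c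
    (fun x => T.le_opNorm x) fun y => ?_, fun x => rfl⟩
  obtain ⟨x, rfl⟩ := (LinearEquiv.ofInjective _ hinj).surjective y
  rw [LinearEquiv.symm_apply_apply]
  exact h x

lemma norm_restrictTo_le {T : X →L[ℝ] Y} {M : Submodule ℝ X} {c : ℝ} (hc : 0 ≤ c)
    (h : ∀ x ∈ M, ‖T x‖ ≤ c * ‖x‖) : ‖restrictTo T M‖ ≤ c :=
  ContinuousLinearMap.opNorm_le_bound _ hc fun x => h x x.2

lemma norm_le_norm_restrictTo (T : X →L[ℝ] Y) {M : Submodule ℝ X} {x : X} (hx : x ∈ M) :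
    ‖T x‖ ≤ ‖restrictTo T M‖ * ‖x‖ :=
  (restrictTo T M).le_opNorm ⟨x, hx⟩

lemma mem_closedSpan (x : ℕ → X) (n : ℕ) : x n ∈ closedSpan x :=
  Submodule.le_topologicalClosure _ (Submodule.subset_span ⟨n, rfl⟩)

end Restriction

/-! ### Disjoint sequences and order continuity of the norm. -/

section BanachLattice

/-- In a normed lattice, a vector all of whose positive multiples have a common upper bound is
not positive. -/
lemma nonpos_of_forall_nsmul_le {E : Type*} [NormedAddCommGroup E] [NormedSpace ℝ E]
    [Lattice E] [IsOrderedAddMonoid E] [HasSolidNorm E] {w v : E}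
    (h : ∀ n : ℕ, n • w⁺ ≤ v) : w ≤ 0 := by
  rw [← posPart_eq_zero, ← norm_eq_zero]
  by_contra hne
  have hpos : 0 < ‖w⁺‖ := lt_of_le_of_ne (norm_nonneg _) (Ne.symm hne)
  obtain ⟨n, hn⟩ := exists_nat_gt (‖v‖ / ‖w⁺‖)
  rw [div_lt_iff₀ hpos] at hn
  have h1 : ‖n • w⁺‖ ≤ ‖v‖ := norm_le_norm_of_abs_le_abs (by
    have h0 : 0 ≤ n • w⁺ := nsmul_nonneg (posPart_nonneg _) n
    rw [abs_of_nonneg h0, abs_of_nonneg (h0.trans (h n))]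
    exact h n)
  rw [← Nat.cast_smul_eq_nsmul ℝ, norm_smul, Real.norm_natCast] at h1
  exact absurd h1 (not_le.2 hn)

lemma IsDisjointSeq.comp_injective {E : Type*} [NormedAddCommGroup E] [Lattice E]
    {x : ℕ → E} (hx : IsDisjointSeq x) {f : ℕ → ℕ}
    (hf : Function.Injective f) : IsDisjointSeq (x ∘ f) :=
  ⟨fun n => hx.1 (f n), fun _ _ h => hx.2 _ _ (hf.ne h)⟩

/-- No supremum of `s` is needed: the gaps between upper bounds and terms already have infimum `0`.
If `w` lies below every gap, `w⁺` can be subtracted from an upper bound again and again, which the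
norm forbids unless `w⁺ = 0`. -/
lemma OrderContinuousNorm.exists_norm_sub_lt {E : Type*} [NormedAddCommGroup E]
    [NormedSpace ℝ E] [Lattice E] [IsOrderedAddMonoid E] [HasSolidNorm E]
    (hE : OrderContinuousNorm E) {s : ℕ → E}
    (hs : Monotone s) (hbdd : BddAbove (Set.range s)) {ε : ℝ} (hε : 0 < ε) :
    ∃ N, ∀ n ≥ N, ‖s n - s N‖ < ε := by
  obtain ⟨v₀, hv₀⟩ := hbdd
  set D : Set E := {d | ∃ v ∈ upperBounds (Set.range s), ∃ n, d = v - s n} with hD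
  have hglb : IsGLB D 0 := by
    constructor
    · rintro _ ⟨v, hv, n, rfl⟩
      exact sub_nonneg.2 (hv ⟨n, rfl⟩)
    · intro w hw
      have hw' : ∀ v ∈ upperBounds (Set.range s), v - w⁺ ∈ upperBounds (Set.range s) := by
        rintro v hv _ ⟨n, rfl⟩
        have : w⁺ ≤ v - s n := sup_le (hw ⟨v, hv, n, rfl⟩) (sub_nonneg.2 (hv ⟨n, rfl⟩))
        exact le_sub_comm.1 this
      have hk : ∀ k : ℕ, v₀ - k • w⁺ ∈ upperBounds (Set.range s) := by
        intro k
        induction k with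
        | zero => simpa using hv₀
        | succ k ih => rw [succ_nsmul, ← sub_sub]; exact hw' _ ih
      exact nonpos_of_forall_nsmul_le fun k => le_sub_comm.1 (hk k ⟨0, rfl⟩)
  have hdir : DirectedOn (· ≥ ·) D := by
    rintro _ ⟨v, hv, n, rfl⟩ _ ⟨v', hv', n', rfl⟩
    refine ⟨v ⊓ v' - s (max n n'), ⟨v ⊓ v', ?_, _, rfl⟩,
      sub_le_sub inf_le_left (hs (le_max_left _ _)),
      sub_le_sub inf_le_right (hs (le_max_right _ _))⟩
    exact fun a ha => le_inf (hv ha) (hv' ha)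
  obtain ⟨_, ⟨v, hv, N, rfl⟩, hN⟩ := hE D ⟨_, v₀, hv₀, 0, rfl⟩ hdir hglb ε hε
  refine ⟨N, fun n hn => lt_of_le_of_lt (norm_le_norm_of_abs_le_abs ?_)
    (hN (v - s N) ⟨v, hv, N, rfl⟩ le_rfl)⟩
  have h0 : 0 ≤ s n - s N := sub_nonneg.2 (hs hn)
  have h1 : s n - s N ≤ v - s N := sub_le_sub_right (hv ⟨n, rfl⟩) _
  rwa [abs_of_nonneg h0, abs_of_nonneg (h0.trans h1)]

variable {E : Type*} [NormedAddCommGroup E] [NormedSpace ℝ E]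
    [Lattice E] [IsOrderedAddMonoid E] [IsOrderedModule ℝ E] [HasSolidNorm E]

lemma IsDisjointSeq.norm_smul_le_norm_sum {x : ℕ → E} (hx : IsDisjointSeq x) (s : Finset ℕ)
    (a : ℕ → ℝ) {k : ℕ} (hk : k ∈ s) : ‖a k • x k‖ ≤ ‖∑ n ∈ s, a n • x n‖ := by
  rw [← Finset.add_sum_erase s _ hk]
  refine norm_le_norm_of_abs_le_abs (abs_le_abs_add_of_disjoint ?_)
  refine disjoint_of_mem_span (s := {x k}) (t := x '' {n | n ≠ k}) ?_
    (Submodule.smul_mem _ _ (Submodule.subset_span rfl))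
    (Submodule.sum_mem _ fun n hn => Submodule.smul_mem _ _
      (Submodule.subset_span ⟨n, Finset.ne_of_mem_erase hn, rfl⟩))
  rintro _ rfl _ ⟨n, hn, rfl⟩
  exact hx.2 k n (Ne.symm hn)

lemma IsDisjointSeq.linearIndependent {x : ℕ → E} (hx : IsDisjointSeq x) :
    LinearIndependent ℝ x := by
  rw [linearIndependent_iff']
  intro s a h k hk
  have := hx.norm_smul_le_norm_sum s a hk
  rw [h, norm_zero, norm_le_zero_iff, smul_eq_zero] at this
  exact this.resolve_right (hx.1 k)

/-- An operator that is summably small along a disjoint sequence is small on its closed span. -/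
lemma IsDisjointSeq.norm_map_le {Y : Type*} [NormedAddCommGroup Y] [NormedSpace ℝ Y]
    {x : ℕ → E} (hx : IsDisjointSeq x) (T : E →L[ℝ] Y) {b : ℕ → ℝ} (hb : Summable b)
    (hTx : ∀ n, ‖T (x n)‖ ≤ b n * ‖x n‖) {y : E} (hy : y ∈ closedSpan x) :
    ‖T y‖ ≤ (∑' n, b n) * ‖y‖ := by
  have hb0 : ∀ n, 0 ≤ b n := fun n =>
    nonneg_of_mul_nonneg_left ((norm_nonneg _).trans (hTx n)) (norm_pos_iff.2 (hx.1 n))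
  have hcl : IsClosed {y : E | ‖T y‖ ≤ (∑' n, b n) * ‖y‖} :=
    isClosed_le (by fun_prop) (by fun_prop)
  refine closure_minimal ?_ hcl hy
  intro y hy
  obtain ⟨c, rfl⟩ := (Finsupp.mem_span_range_iff_exists_finsupp).1 hy
  simp only [Finsupp.sum, Set.mem_ofPred_eq, map_sum, map_smul]
  calc ‖∑ n ∈ c.support, c n • T (x n)‖ ≤ ∑ n ∈ c.support, ‖c n • T (x n)‖ := norm_sum_le _ _
    _ ≤ ∑ n ∈ c.support, b n * ‖∑ n ∈ c.support, c n • x n‖ := by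
        refine Finset.sum_le_sum fun n hn => ?_
        calc ‖c n • T (x n)‖ ≤ ‖c n‖ * (b n * ‖x n‖) := by
              rw [norm_smul]; exact mul_le_mul_of_nonneg_left (hTx n) (norm_nonneg _)
          _ = b n * ‖c n • x n‖ := by rw [norm_smul]; ring
          _ ≤ _ := mul_le_mul_of_nonneg_left (hx.norm_smul_le_norm_sum _ _ hn) (hb0 n)
    _ = (∑ n ∈ c.support, b n) * ‖∑ n ∈ c.support, c n • x n‖ := by rw [Finset.sum_mul]
    _ ≤ _ := mul_le_mul_of_nonneg_right (hb.sum_le_tsum _ fun n _ => hb0 n) (norm_nonneg _)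

/-- With order continuous norm, a disjoint sequence becomes small when truncated at a positive
vector. -/
lemma OrderContinuousNorm.exists_norm_inf_lt (hE : OrderContinuousNorm E) {x : ℕ → E}
    (hx : IsDisjointSeq x) {u : E} (hu : 0 ≤ u) {ε : ℝ} (hε : 0 < ε) :
    ∃ n, ‖|x n| ⊓ u‖ < ε := by
  have h0 : ∀ n, 0 ≤ |x n| ⊓ u := fun n => le_inf (abs_nonneg _) hu
  have hle := sum_le_of_pairwise_disjoint hu h0 (fun n => inf_le_right) fun m n hmn =>
    inf_eq_zero_of_le (hx.2 m n hmn) (h0 m) (h0 n) inf_le_left inf_le_left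
  obtain ⟨N, hN⟩ := hE.exists_norm_sub_lt (s := fun n => ∑ i ∈ Finset.range n, |x i| ⊓ u)
    (monotone_nat_of_le_succ fun n => by
      rw [Finset.sum_range_succ]; exact le_add_of_nonneg_right (h0 n))
    ⟨u, by rintro _ ⟨n, rfl⟩; exact hle n⟩ hε
  refine ⟨N, ?_⟩
  simpa [Finset.sum_range_succ] using hN (N + 1) (Nat.le_succ N)

end BanachLattice

/-! ### Strict singularity, blocks and disjoint perturbation. -/

section Main

lemma exists_mem_span_image_Ico {E : Type*} [NormedAddCommGroup E] [NormedSpace ℝ E]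
    {x : ℕ → E} {N : ℕ} {y : E} (hy : y ∈ Submodule.span ℝ (x '' Set.Ici N)) :
    ∃ N', N < N' ∧ y ∈ Submodule.span ℝ (x '' Set.Ico N N') := by
  have hmono : ∀ {a b : ℕ}, a ≤ b →
      Submodule.span ℝ (x '' Set.Ico N a) ≤ Submodule.span ℝ (x '' Set.Ico N b) := fun h =>
    Submodule.span_mono (Set.image_mono (Set.Ico_subset_Ico_right h))
  induction hy using Submodule.span_induction with
  | mem y hy =>
    obtain ⟨n, hn, rfl⟩ := hy
    exact ⟨n + 1, Nat.lt_succ_of_le hn, Submodule.subset_span ⟨n, ⟨hn, n.lt_succ_self⟩, rfl⟩⟩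
  | zero => exact ⟨N + 1, N.lt_succ_self, Submodule.zero_mem _⟩
  | add y z _ _ hy hz =>
    obtain ⟨a, ha, hya⟩ := hy
    obtain ⟨b, hb, hzb⟩ := hz
    exact ⟨max a b, lt_max_of_lt_left ha, Submodule.add_mem _
      (hmono (le_max_left a b) hya) (hmono (le_max_right a b) hzb)⟩
  | smul c y _ hy =>
    obtain ⟨a, ha, hya⟩ := hy
    exact ⟨a, ha, Submodule.smul_mem _ c hya⟩

lemma exists_norm_restrictTo_lt_of_gammad_eq_zero {E Y : Type*} [NormedAddCommGroup E]
    [NormedSpace ℝ E] [Lattice E] [NormedAddCommGroup Y] [NormedSpace ℝ Y]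
    {T : E →L[ℝ] Y} (h : Gammad T = 0) {ε : ℝ} (hε : 0 < ε) : ∃ x : ℕ → E, IsDisjointSeq x ∧ ‖restrictTo T (closedSpan x)‖ < ε := by
  have hlt : Gammad T < ENNReal.ofReal ε := h ▸ ENNReal.ofReal_pos.2 hε
  simp only [Gammad, iInf_lt_iff] at hlt
  obtain ⟨x, hx, hlt⟩ := hlt
  exact ⟨x, hx, (ENNReal.ofReal_lt_ofReal_iff hε).1 hlt⟩

lemma gammad_le_norm_restrictTo {E Y : Type*} [NormedAddCommGroup E] [NormedSpace ℝ E]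
    [Lattice E] [NormedAddCommGroup Y] [NormedSpace ℝ Y] (T : E →L[ℝ] Y)
    {x : ℕ → E} (hx : IsDisjointSeq x) :
    Gammad T ≤ ENNReal.ofReal ‖restrictTo T (closedSpan x)‖ :=
  iInf₂_le x hx

lemma IsDisjointSeq.normalize {E : Type*} [NormedAddCommGroup E] [NormedSpace ℝ E] [Lattice E]
    [IsOrderedAddMonoid E] [IsOrderedModule ℝ E] {x : ℕ → E} (hx : IsDisjointSeq x) :
    IsDisjointSeq fun n => ‖x n‖⁻¹ • x n := by
  refine ⟨fun n => smul_ne_zero (inv_ne_zero (norm_ne_zero_iff.2 (hx.1 n))) (hx.1 n),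
    fun m n hmn => disjoint_of_mem_span (s := {x m}) (t := {x n}) ?_
      (Submodule.smul_mem _ _ (Submodule.subset_span rfl))
      (Submodule.smul_mem _ _ (Submodule.subset_span rfl))⟩
  rintro _ rfl _ rfl
  exact hx.2 m n hmn

variable {E Y : Type*} [NormedAddCommGroup E] [NormedSpace ℝ E]
    [Lattice E] [IsOrderedAddMonoid E] [IsOrderedModule ℝ E] [HasSolidNorm E]
    [NormedAddCommGroup Y] [NormedSpace ℝ Y]

/-- If `T` were bounded below on `M`, then `M` would meet trivially a tail span on which `T` is
small enough. That tail has finite codimension in `[x_n]`, so `M` would be finite dimensional. -/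
lemma IsDisjointSeq.strictlySingular {x : ℕ → E} (hx : IsDisjointSeq x) (T : E →L[ℝ] Y)
    {b : ℕ → ℝ} (hb : Summable b) (hTx : ∀ n, ‖T (x n)‖ ≤ b n * ‖x n‖) :
    StrictlySingular (restrictTo T (closedSpan x)) := by
  rintro ⟨M, -, hMinf, hiso⟩
  obtain ⟨c, hc, hM⟩ := hiso.exists_norm_le
  obtain ⟨N, hN⟩ : ∃ N, c * ∑' n, b (n + N) < 1 := by
    have h := (tendsto_sum_nat_add b).const_mul c
    rw [mul_zero] at h
    exact (h.eventually_lt_const one_pos).exists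
  set G := closedSpan (x ∘ (· + N)) with hG
  set F := Submodule.span ℝ (x '' Set.Iio N) with hF
  have hFfin : FiniteDimensional ℝ F :=
    FiniteDimensional.span_of_finite ℝ ((Set.finite_Iio N).image x)
  have hsup : closedSpan x ≤ G ⊔ F := by
    refine Submodule.topologicalClosure_minimal _ (Submodule.span_le.2 ?_)
      (Submodule.isClosed_sup_finiteDimensional _ _ (Submodule.isClosed_topologicalClosure _))
    rintro _ ⟨n, rfl⟩
    rcases lt_or_ge n N with h | h
    · exact Submodule.mem_sup_right (Submodule.subset_span ⟨n, h, rfl⟩)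
    · refine Submodule.mem_sup_left ?_
      have := mem_closedSpan (x ∘ (· + N)) (n - N)
      rwa [Function.comp_apply, Nat.sub_add_cancel h] at this
  have hker : ∀ m : M, ((m : closedSpan x) : E) ∈ G → m = 0 := by
    intro m hm
    have h1 : ‖T ((m : closedSpan x) : E)‖ ≤ (∑' n, b (n + N)) * ‖m‖ :=
      (hx.comp_injective (add_left_injective N)).norm_map_le T
        (b := fun n => b (n + N)) ((summable_nat_add_iff N).2 hb) (fun n => hTx _) hm
    have h2 : ‖m‖ ≤ (c * ∑' n, b (n + N)) * ‖m‖ := by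
      rw [mul_assoc]
      exact (hM m).trans (mul_le_mul_of_nonneg_left h1 hc)
    by_contra hne
    have hpos : 0 < ‖m‖ := norm_pos_iff.2 hne
    exact absurd h2 (not_le.2 (by simpa using mul_lt_mul_of_pos_right hN hpos))
  let φ : M →ₗ[ℝ] E ⧸ G := G.mkQ ∘ₗ (closedSpan x).subtype ∘ₗ M.subtype
  have hφ : ∀ m, φ m ∈ F.map G.mkQ := by
    intro m
    obtain ⟨g, hg, f, hf, hgf⟩ := Submodule.mem_sup.1 (hsup (m : closedSpan x).2)
    refine ⟨f, hf, ?_⟩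
    change G.mkQ f = G.mkQ ((m : closedSpan x) : E)
    rw [← hgf, map_add, Submodule.mkQ_apply G g, (Submodule.Quotient.mk_eq_zero G).2 hg, zero_add]
  refine hMinf (FiniteDimensional.of_injective (φ.codRestrict (F.map G.mkQ) hφ) ?_)
  rw [injective_iff_map_eq_zero]
  intro m hm
  exact hker m ((Submodule.Quotient.mk_eq_zero G).1 (congrArg Subtype.val hm))

/-- Otherwise `T` is bounded below on the closed tail span, an infinite dimensional subspace of
`[x_n]`. -/
lemma IsDisjointSeq.exists_mem_span_tail {x : ℕ → E} (hx : IsDisjointSeq x) {T : E →L[ℝ] Y}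
    (hT : StrictlySingular (restrictTo T (closedSpan x))) (N : ℕ) {ε : ℝ} (hε : 0 < ε) :
    ∃ y ∈ Submodule.span ℝ (x '' Set.Ici N), ‖T y‖ < ε * ‖y‖ := by
  by_contra! hcon
  set L := (Submodule.span ℝ (x '' Set.Ici N)).topologicalClosure with hL
  have hbd : ∀ y ∈ L, ε * ‖y‖ ≤ ‖T y‖ := by
    have hcl : IsClosed {y : E | ε * ‖y‖ ≤ ‖T y‖} := isClosed_le (by fun_prop) (by fun_prop)
    exact fun y hy => closure_minimal hcon hcl hy
  refine hT ⟨L.comap (closedSpan x).subtype, ?_, ?_, ?_⟩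
  · exact (Submodule.isClosed_topologicalClosure _).preimage continuous_subtype_val
  · intro hfin
    have hmem : ∀ n, x (n + N) ∈ L := fun n =>
      Submodule.le_topologicalClosure _ (Submodule.subset_span ⟨n + N, Nat.le_add_left _ _, rfl⟩)
    let v : ℕ → L.comap (closedSpan x).subtype :=
      fun n => ⟨⟨x (n + N), mem_closedSpan x _⟩, hmem n⟩
    have hv : LinearIndependent ℝ v :=
      LinearIndependent.of_comp
        ((closedSpan x).subtype ∘ₗ (L.comap (closedSpan x).subtype).subtype)
        (hx.comp_injective (add_left_injective N)).linearIndependent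
    have := hv.finite
    exact not_finite ℕ
  · refine isIsoOntoRange_of_norm_le (c := ε⁻¹) fun y => ?_
    rw [le_inv_mul_iff₀ hε]
    exact hbd _ y.2

/-- A strictly singular operator on the span of a disjoint sequence is arbitrarily small along
some disjoint block sequence. -/
lemma IsDisjointSeq.exists_block {x : ℕ → E} (hx : IsDisjointSeq x) {T : E →L[ℝ] Y}
    (hT : StrictlySingular (restrictTo T (closedSpan x))) {δ : ℕ → ℝ} (hδ : ∀ k, 0 < δ k) :
    ∃ y : ℕ → E, IsDisjointSeq y ∧ ∀ k, ‖T (y k)‖ ≤ δ k * ‖y k‖ := by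
  have key : ∀ N k : ℕ, ∃ (y : E) (N' : ℕ), N < N' ∧ y ∈ Submodule.span ℝ (x '' Set.Ico N N') ∧
      ‖T y‖ < δ k * ‖y‖ := fun N k => by
    obtain ⟨y, hy, hTy⟩ := hx.exists_mem_span_tail hT N (hδ k)
    obtain ⟨N', hN', hy'⟩ := exists_mem_span_image_Ico hy
    exact ⟨y, N', hN', hy', hTy⟩
  choose y B hB hy hTy using key
  -- Block boundaries: the `k`-th vector uses only the indices in `[s k, s (k + 1))`.
  let s : ℕ → ℕ := fun k => Nat.rec 0 (fun k a => B a k) k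
  have hs : StrictMono s := strictMono_nat_of_lt_succ fun k => hB (s k) k
  have hlt : ∀ m n, m < n → |y (s m) m| ⊓ |y (s n) n| = 0 := by
    intro m n hmn
    refine disjoint_of_mem_span ?_ (hy (s m) m) (hy (s n) n)
    rintro _ ⟨i, hi, rfl⟩ _ ⟨j, hj, rfl⟩
    have h1 : i < s (m + 1) := hi.2
    exact hx.2 i j (ne_of_lt (h1.trans_le ((hs.monotone hmn).trans hj.1)))
  refine ⟨fun k => y (s k) k, ⟨fun k h0 => ?_, fun m n hmn => ?_⟩, fun k => (hTy (s k) k).le⟩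
  · have := hTy (s k) k
    rw [show y (s k) k = 0 from h0] at this
    simp at this
  · rcases lt_or_gt_of_ne hmn with h | h
    · exact hlt m n h
    · rw [inf_comm]; exact hlt n m h

/-- A sequence of vectors that can be chosen almost disjoint from any given positive vector has
a choice close to a disjoint sequence. -/
lemma exists_disjoint_perturbation [CompleteSpace E] {P : ℕ → E → Prop}
    (hP : ∀ k u, 0 ≤ u → ∀ ε : ℝ, 0 < ε → ∃ y, P k y ∧ ‖|y| ⊓ u‖ < ε)
    (hnorm : ∀ k y, P k y → ‖y‖ ≤ 1) :
    ∃ y d : ℕ → E, (∀ k, P k (y k)) ∧ (∀ k, ‖y k - d k‖ ≤ (1 / 2) ^ (k + 1)) ∧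
      ∀ m n, m ≠ n → |d m| ⊓ |d n| = 0 := by
  -- Chosen so that the inverses of `C i` over `i > k` sum to `(1 / 2) ^ (k + 2)`.
  let C : ℕ → ℝ := fun i => 2 ^ (i + 2)
  have hC : ∀ i, 0 < C i := fun i => by positivity
  have key : ∀ (k : ℕ) (u : E), ∃ y, 0 ≤ u → P k y ∧ ‖|y| ⊓ C k • u‖ < (1 / 2) ^ (k + 2) := by
    intro k u
    by_cases hu : 0 ≤ u
    · obtain ⟨y, hy⟩ := hP k (C k • u) (smul_nonneg (hC k).le hu) ((1 / 2) ^ (k + 2))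
        (by positivity)
      exact ⟨y, fun _ => hy⟩
    · exact ⟨0, fun h => absurd h hu⟩
  choose Z hZ using key
  -- `S k` is the sum of `|y j|` over `j < k`; each `y k` is chosen almost disjoint from `C k • S
  -- k`.
  let S : ℕ → E := fun k => Nat.rec 0 (fun k u => u + |Z k u|) k
  let y : ℕ → E := fun k => Z k (S k)
  have hSsucc : ∀ k, S (k + 1) = S k + |y k| := fun k => rfl
  have hSmono : Monotone S := monotone_nat_of_le_succ fun k => by
    rw [hSsucc]; exact le_add_of_nonneg_right (abs_nonneg _)
  have hS0 : ∀ k, 0 ≤ S k := fun k => hSmono (Nat.zero_le k)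
  have hyS : ∀ j k, j < k → |y j| ≤ S k := fun j k hjk =>
    (le_add_of_nonneg_left (hS0 j)).trans (hSmono hjk : S (j + 1) ≤ S k)
  have hy : ∀ k, P k (y k) := fun k => (hZ k (S k) (hS0 k)).1
  let t : ℕ → ℕ → E := fun k j => (C (k + 1 + j))⁻¹ • |y (k + 1 + j)|
  have ht0 : ∀ k j, 0 ≤ t k j := fun k j => smul_nonneg (inv_pos.2 (hC _)).le (abs_nonneg _)
  have htn : ∀ k j, ‖t k j‖ ≤ (1 / 2) ^ (k + 3) * (1 / 2) ^ j := fun k j => by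
    rw [norm_smul, norm_abs_eq_norm, Real.norm_of_nonneg (inv_pos.2 (hC _)).le]
    calc (C (k + 1 + j))⁻¹ * ‖y (k + 1 + j)‖ ≤ (C (k + 1 + j))⁻¹ * 1 :=
          mul_le_mul_of_nonneg_left (hnorm _ _ (hy _)) (inv_pos.2 (hC _)).le
      _ = (1 / 2) ^ (k + 3) * (1 / 2) ^ j := by
          rw [mul_one, ← pow_add, one_div, inv_pow, show k + 3 + j = k + 1 + j + 2 by omega]
  have hgeo : ∀ k : ℕ, HasSum (fun j : ℕ => (1 / 2 : ℝ) ^ (k + 3) * (1 / 2) ^ j)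
      ((1 / 2) ^ (k + 2)) := fun k => by
    have := hasSum_geometric_two.mul_left ((1 / 2 : ℝ) ^ (k + 3))
    rwa [show (1 / 2 : ℝ) ^ (k + 3) * 2 = (1 / 2) ^ (k + 2) by rw [pow_succ _ (k + 2)]; ring]
      at this
  have htsum : ∀ k, Summable (t k) := fun k => .of_norm_bounded (hgeo k).summable (htn k)
  have htnorm : ∀ k, ‖∑' j, t k j‖ ≤ (1 / 2) ^ (k + 2) := fun k =>
    tsum_of_norm_bounded (hgeo k) (htn k)
  have htail0 : ∀ k, 0 ≤ ∑' j, t k j := fun k => tsum_nonneg (ht0 k)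
  -- The first term separates `y k` from its predecessors, the second from its successors. For `j <
  -- k` both truncations use the same constant `C k`, and each term costs at most `(1 / 2) ^ (k +
  -- 2)` in norm.
  let z : ℕ → E := fun k => C k • S k + ∑' j, t k j
  have hCS : ∀ k, 0 ≤ C k • S k := fun k => smul_nonneg (hC k).le (hS0 k)
  have hz0 : ∀ k, 0 ≤ z k := fun k => add_nonneg (hCS k) (htail0 k)
  have hlt : ∀ j k, j < k → |excess (y j) (z j)| ⊓ |excess (y k) (z k)| = 0 := by
    intro j k hjk
    refine excess_inf_excess_eq_zero (hC k) ?_ ?_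
    · obtain ⟨i, rfl⟩ := Nat.exists_eq_add_of_lt hjk
      have h := (htsum j).le_tsum i fun i _ => ht0 j i
      rw [add_right_comm]
      exact h.trans (le_add_of_nonneg_left (hCS j))
    · exact (smul_le_smul_of_nonneg_left (hyS j k hjk) (hC k).le).trans
        (le_add_of_nonneg_right (htail0 k))
  refine ⟨y, fun k => excess (y k) (z k), hy, fun k => ?_, fun m n hmn => ?_⟩
  · have h1 : |y k - excess (y k) (z k)| ≤ |y k| ⊓ C k • S k + ∑' j, t k j :=
      (abs_sub_excess_le _ (hz0 k)).trans
        ((inf_add_le_inf_add_inf (abs_nonneg _) (hCS k) (htail0 k)).trans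
          (add_le_add_right inf_le_right _))
    calc ‖y k - excess (y k) (z k)‖ ≤ ‖|y k| ⊓ C k • S k + ∑' j, t k j‖ :=
          norm_le_norm_of_abs_le_abs (h1.trans (le_abs_self _))
      _ ≤ (1 / 2) ^ (k + 2) + (1 / 2) ^ (k + 2) :=
          (norm_add_le _ _).trans (add_le_add (hZ k (S k) (hS0 k)).2.le (htnorm k))
      _ = (1 / 2) ^ (k + 1) := by rw [pow_succ _ (k + 1)]; ring
  · rcases lt_or_gt_of_ne hmn with h | h
    · exact hlt m n h
    · rw [inf_comm]; exact hlt n m h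

/-! ### The two implications. -/

lemma disjointlyNonSingular_of_gammad_pos {T : E →L[ℝ] Y} (h : 0 < Gammad T) :
    DisjointlyNonSingular T := by
  rintro ⟨x, hx, hT⟩
  refine h.ne' (le_antisymm (ENNReal.le_of_forall_pos_le_add fun ε hε _ => ?_) zero_le)
  -- These ratios sum to exactly `ε`.
  obtain ⟨y, hy, hTy⟩ := hx.exists_block hT (δ := fun k => ε / 2 / 2 ^ k) fun k => by
    have : (0 : ℝ) < ε := hε
    positivity
  refine (gammad_le_norm_restrictTo T hy).trans ?_
  rw [zero_add]
  refine (ENNReal.ofReal_le_ofReal (norm_restrictTo_le ε.2 fun v hv => ?_)).trans_eq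
    ENNReal.ofReal_coe_nnreal
  have := hy.norm_map_le T (summable_geometric_two' (ε : ℝ)) hTy hv
  rwa [tsum_geometric_two'] at this

lemma gammad_pos_of_disjointlyNonSingular [CompleteSpace E] (hE : OrderContinuousNorm E)
    {T : E →L[ℝ] Y} (h : DisjointlyNonSingular T) : 0 < Gammad T := by
  rw [pos_iff_ne_zero]
  intro h0
  obtain ⟨y, d, hy, hyd, hd⟩ := exists_disjoint_perturbation (E := E)
    (P := fun k y => ‖y‖ = 1 ∧ ‖T y‖ ≤ (1 / 2) ^ k)
    (fun k u hu ε hε => by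
      obtain ⟨x, hx, hTx⟩ := exists_norm_restrictTo_lt_of_gammad_eq_zero h0
        (ε := (1 / 2) ^ k) (by positivity)
      obtain ⟨n, hn⟩ := hE.exists_norm_inf_lt hx.normalize hu hε
      have h1 : ‖‖x n‖⁻¹ • x n‖ = 1 := norm_smul_inv_norm (𝕜 := ℝ) (hx.1 n)
      refine ⟨‖x n‖⁻¹ • x n, ⟨h1, ?_⟩, hn⟩
      have := norm_le_norm_restrictTo T (Submodule.smul_mem _ ‖x n‖⁻¹ (mem_closedSpan x n))
      rw [h1, mul_one] at this
      exact this.trans hTx.le)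
    fun k y hy => hy.1.le
  have hd2 : ∀ k, 1 / 2 ≤ ‖d k‖ := fun k => by
    have h1 : (1 / 2 : ℝ) ^ (k + 1) ≤ 1 / 2 :=
      pow_le_of_le_one (by norm_num) (by norm_num) k.succ_ne_zero
    have h2 := norm_sub_norm_le (y k) (d k)
    have h3 := hyd k
    rw [(hy k).1] at h2
    linarith
  have hdisj : IsDisjointSeq d :=
    ⟨fun k hk => by have := hd2 k; rw [hk, norm_zero] at this; norm_num at this, hd⟩
  -- The factor `2` compensates for `‖d k‖ ≥ 1 / 2`; the term `‖T‖` pays for replacing `y k` by `d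
  -- k`.
  refine h ⟨d, hdisj, hdisj.strictlySingular T (b := fun k => 2 * (1 + ‖T‖) * (1 / 2) ^ k)
    (summable_geometric_two.mul_left _) fun k => ?_⟩
  calc ‖T (d k)‖ = ‖T (y k) - T (y k - d k)‖ := by rw [← map_sub, sub_sub_cancel]
    _ ≤ (1 / 2) ^ k + ‖T‖ * (1 / 2) ^ (k + 1) :=
        (norm_sub_le _ _).trans (add_le_add (hy k).2
          ((T.le_opNorm _).trans (mul_le_mul_of_nonneg_left (hyd k) (norm_nonneg T))))
    _ ≤ (1 / 2) ^ k + ‖T‖ * (1 / 2) ^ k := by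
        have : (1 / 2 : ℝ) ^ (k + 1) ≤ (1 / 2) ^ k :=
          pow_le_pow_of_le_one (by norm_num) (by norm_num) k.le_succ
        gcongr
    _ = 2 * (1 + ‖T‖) * (1 / 2) ^ k * (1 / 2) := by ring
    _ ≤ 2 * (1 + ‖T‖) * (1 / 2) ^ k * ‖d k‖ := mul_le_mul_of_nonneg_left (hd2 k) (by positivity)

end Main
end BanachLat

theorem theorem4p2 {E Y : Type*}
    [NormedAddCommGroup E] [NormedSpace ℝ E] [CompleteSpace E]
    [Lattice E] [IsOrderedAddMonoid E] [IsOrderedModule ℝ E] [HasSolidNorm E]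
    [NormedAddCommGroup Y] [NormedSpace ℝ Y] [CompleteSpace Y]
    (hE : BanachLat.OrderContinuousNorm E) (T : E →L[ℝ] Y) :
    BanachLat.DisjointlyNonSingular T ↔ 0 < BanachLat.Gammad T :=
  ⟨BanachLat.gammad_pos_of_disjointlyNonSingular hE,
    BanachLat.disjointlyNonSingular_of_gammad_pos⟩
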